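/- Let $q=p^h$ be a power of a prime $p$, and let $r\ge 1$ be an integer with $r<h$ and $2r\mid h$. Put $$n=\frac{q-1}{p^r-1},\qquad m=\frac{q-1}{p^r+1}.$$ Let $a,b,c\in\mathbb F_{p^{2r}}^{*}\subseteq\mathbb F_q^*$ satisfy $c\neq -a/b$, $-b=c\,a^{p^r}$, $-a=c\,b^{p^r}$ and $c^{p^r+1}=1$. Then the polynomial $ax^ny^m+bx^n+cy^m-1$ is irreducible over $\mathbb F_q$. Let $\mathcal F$ be the projective closure of the affine curve $ax^ny^m+bx^n+cy^m=1$, and let $N_q(\mathcal F)$ be the number of its $\mathbb F_q$-rational points counted on the nonsingular model, that is, the number of $\mathbb F_q$-rational branches of $\mathcal F$, or equivalently of places of degree one of the function field $\mathbb F_q(\mathcal F)$. Then $$N_q(\mathcal F)=\left(\frac{q-1}{p^{2r}-1}\right)^2N'_{p^{2r}}(\mathcal G)+\bigl(\delta(c)+\delta(-b/a)\bigr)\,m+\bigl(\gamma(-c/a)+\gamma(b)\bigr)\,n .$$ Here $N'_{p^{2r}}(\mathcal G)$ is the number of pairs $(x,y)\in\mathbb F_{p^{2r}}^2$ with $xy\neq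 0$ and $$ax^{p^r+1}y^{p^r-1}+bx^{p^r+1}+cy^{p^r-1}-1=0 .$$ For $d\in\mathbb F_{p^{2r}}^*$, $\delta(d)=1$ if $d$ is a $(p^r-1)$-th power in $\mathbb F_{p^{2r}}$ and $\delta(d)=0$ otherwise; and $\gamma(d)=1$ if $d\in\mathbb F_{p^r}$ and $\gamma(d)=0$ otherwise. -/

import Mathlib

open MvPolynomial

noncomputable section

namespace RatPts

/-- For a finite field `k` with `p ^ h` elements and `d ∣ h`, the subfield `𝔽_{p^d}` of `k`, that is,
the set of all `x` in `k` with `x ^ (p ^ d) = x`. -/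
def fixedSubfield (k : Type*) [Field k] (p : ℕ) [ExpChar k p] (d : ℕ) : Subfield k :=
  (iterateFrobenius k p d).eqLocusField (RingHom.id k)

variable {k : Type*} [Field k]

/-- The affine coordinate ring `k[x, y] / (f)` of the plane curve `f = 0`. -/
abbrev CoordRing (f : MvPolynomial (Fin 2) k) : Type _ :=
  MvPolynomial (Fin 2) k ⧸ Ideal.span {f}

theorem isDomain_coordRing {f : MvPolynomial (Fin 2) k} (hf : Irreducible f) :
    IsDomain (CoordRing f) :=
  (Ideal.Quotient.isDomain_iff_prime _).2
    ((Ideal.span_singleton_prime hf.ne_zero).2 hf.prime)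

/-- A valuation ring `A` of an extension field `K` of `k` is a rational place of `K / k` if it is not
`K` itself, contains `k`, and its residue field is `k`: every element of `A` is congruent to a
constant modulo the maximal ideal of `A`. -/
def IsRationalPlace (k : Type*) [Field k] {K : Type*} [Field K] [Algebra k K]
    (A : ValuationSubring K) : Prop :=
  A ≠ ⊤ ∧ (∀ t : k, algebraMap k K t ∈ A) ∧
    ∀ u ∈ A, ∃ t : k, u - algebraMap k K t ∈ A.nonunits

/-- The number of `k`-rational points of the curve that is the projective closure of `f = 0`, counted
on its nonsingular model: the number of rational branches of the curve, which are the places of degree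
one of its function field `k(x, y)`, the field of fractions of `k[x, y] / (f)`. -/
def numRationalPoints (f : MvPolynomial (Fin 2) k) (hf : Irreducible f) : ℕ :=
  haveI := isDomain_coordRing hf
  Nat.card {A : ValuationSubring (FractionRing (CoordRing f)) // IsRationalPlace k A}

/-- The polynomial `a x^n y^m + b x^n + c y^m - 1`. -/
def curvePoly (a b c : k) (n m : ℕ) : MvPolynomial (Fin 2) k :=
  C a * X 0 ^ n * X 1 ^ m + C b * X 0 ^ n + C c * X 1 ^ m - 1

/-- The number of points `(x, y)` with `x y ≠ 0` and coordinates in `k` on the affine curve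
`f = 0`. -/
def numTorusPoints (f : MvPolynomial (Fin 2) k) : ℕ :=
  Nat.card {P : k × k // P.1 * P.2 ≠ 0 ∧ eval ![P.1, P.2] f = 0}

open Classical in
/-- The indicator of the `s`-th powers in `k`. -/
def powInd (s : ℕ) (d : k) : ℕ := if ∃ z : k, z ^ s = d then 1 else 0

open Classical in
/-- The indicator of membership in a subfield. -/
def memInd (S : Subfield k) (d : k) : ℕ := if d ∈ S then 1 else 0

end RatPts

end

namespace RatPts

variable {k : Type*} [Field k]

/-! The closure of the curve in ℙ¹ × ℙ¹, unlike the one in the plane, is smooth at every rational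
point. In `u = x ^ n`, `v = y ^ m` the equation is bilinear and gives `(a u + c) (a v + b) = a + b c
≠ 0`; since `p` divides neither `n` nor `m`, one partial derivative is nonzero at each affine point.
Replacing `x` or `y` by its inverse preserves the shape of the equation (`IsModel.inv`), which
settles infinity. A smooth rational point carries exactly one rational place
(`existsUnique_rationalPlace_of_isFractionRing`), so places are counted by points of ℙ¹ × ℙ¹
(`IsModel.card_rationalPlace`).

The points with `x` or `y` in `{0, ∞}` solve equations `x ^ n = d` or `y ^ m = d` and give the terms
in `n` and `m`. Points with `x y ≠ 0` lie over pairs `(u, v)` of roots of unity of orders dividing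
`p ^ r - 1` and `p ^ r + 1`. These pairs lie in 𝔽_{p^{2r}} and are the same for the small curve, so
the two torus counts differ only by the sizes of the fibres (`numTorusPoints_curvePoly`). -/

theorem eval_curvePoly (a b c : k) (n m : ℕ) (P : Fin 2 → k) :
    eval P (curvePoly a b c n m) =
      a * P 0 ^ n * P 1 ^ m + b * P 0 ^ n + c * P 1 ^ m - 1 := by
  simp [curvePoly]

theorem aeval_curvePoly {R : Type*} [CommRing R] [Algebra k R] (a b c : k) (n m : ℕ)
    (P : Fin 2 → R) :
    aeval P (curvePoly a b c n m) =
      algebraMap k R a * P 0 ^ n * P 1 ^ m + algebraMap k R b * P 0 ^ n +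
        algebraMap k R c * P 1 ^ m - 1 := by
  simp [curvePoly]

/-! ### Irreducibility -/

theorem finSuccEquiv_curvePoly (a b c : k) (n m : ℕ) :
    finSuccEquiv k 1 (curvePoly a b c n m) =
      Polynomial.C (C a * X 0 ^ m + C b) * Polynomial.X ^ n +
        Polynomial.C (C c * X 0 ^ m - 1) := by
  have h1 : finSuccEquiv k 1 (X 1) = Polynomial.C (X 0) := finSuccEquiv_X_succ (j := 0)
  have hC : ∀ t : k, finSuccEquiv k 1 (C t) = Polynomial.C (C t) := fun t => by
    simp [finSuccEquiv_apply]
  simp only [curvePoly, map_sub, map_add, map_mul, map_pow, finSuccEquiv_X_zero, h1, hC, map_one]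
  ring

theorem coeff_lead_ne_zero (a : k) {b : k} {m : ℕ} (hb : b ≠ 0) (hm : m ≠ 0) :
    (C a * X 0 ^ m + C b : MvPolynomial (Fin 1) k) ≠ 0 := fun h => by
  have := congrArg (eval 0) h
  simp [hm, hb] at this

theorem natDegree_finSuccEquiv_curvePoly (a c : k) {b : k} (n : ℕ) {m : ℕ} (hb : b ≠ 0)
    (hm : m ≠ 0) : (finSuccEquiv k 1 (curvePoly a b c n m)).natDegree = n := by
  rw [finSuccEquiv_curvePoly, Polynomial.natDegree_add_C,
    Polynomial.natDegree_C_mul_X_pow _ _ (coeff_lead_ne_zero a hb hm)]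

/-- Eisenstein's criterion in `x` over `k[y]`, at the prime of the point `y = η`: this is a simple
root of the constant term `c y ^ m - 1`, and `a + b c ≠ 0` keeps it from being a root of the leading
coefficient `a y ^ m + b`. -/
theorem irreducible_curvePoly {a b c : k} {n m : ℕ} (hb : b ≠ 0) (hc : c ≠ 0)
    (habc : a + b * c ≠ 0) (hn : n ≠ 0) (hm : (m : k) ≠ 0) {η : k} (hη : c * η ^ m = 1) :
    Irreducible (curvePoly a b c n m) := by
  have hm0 : m ≠ 0 := by rintro rfl; simp at hm
  have hη0 : η ≠ 0 := by rintro rfl; simp [hm0] at hη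
  rw [← MulEquiv.irreducible_iff (finSuccEquiv k 1)]
  have hdeg := natDegree_finSuccEquiv_curvePoly a c n hb hm0
  set g := finSuccEquiv k 1 (curvePoly a b c n m) with hg
  rw [finSuccEquiv_curvePoly] at hg
  have hlead : g.coeff n = C a * X 0 ^ m + C b := by
    rw [hg, Polynomial.coeff_add, Polynomial.coeff_C_mul_X_pow, Polynomial.coeff_C]
    simp [hn]
  have hconst : g.coeff 0 = C c * X 0 ^ m - 1 := by
    rw [hg, Polynomial.coeff_add, Polynomial.coeff_C_mul_X_pow, Polynomial.coeff_C]
    simp [hn.symm]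
  set P : Ideal (MvPolynomial (Fin 1) k) := RingHom.ker (eval fun _ => η) with hP
  have hPp : P.IsPrime := RingHom.ker_isPrime _
  refine Polynomial.IsEisensteinAt.irreducible (𝓟 := P) ⟨?_, ?_, ?_⟩ hPp ?_ ?_
  · rw [Polynomial.leadingCoeff, hdeg, hlead, hP, RingHom.mem_ker]
    intro h
    simp only [map_add, map_mul, eval_C, map_pow, eval_X] at h
    apply habc
    linear_combination (-a) * hη + c * h
  · intro i hi
    rw [hdeg] at hi
    by_cases hi0 : i = 0
    · subst hi0
      rw [hconst, hP, RingHom.mem_ker]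
      simp [hη]
    · have : g.coeff i = 0 := by
        rw [hg, Polynomial.coeff_add, Polynomial.coeff_C_mul_X_pow, Polynomial.coeff_C]
        simp [hi0, hi.ne]
      rw [this]
      exact P.zero_mem
  -- Membership of the constant term in `P ^ 2` would force its derivative `c m y ^ (m - 1)` to
  -- vanish at `η`.
  · have key : ∀ z ∈ P ^ 2, pderiv 0 z ∈ P := by
      intro z hz
      rw [pow_two] at hz
      refine Submodule.mul_induction_on hz (fun u hu v hv => ?_) (fun u v hu hv => ?_)
      · rw [Derivation.leibniz, smul_eq_mul, smul_eq_mul]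
        exact P.add_mem (P.mul_mem_right _ hu) (P.mul_mem_right _ hv)
      · rw [map_add]
        exact P.add_mem hu hv
    intro h
    have h' := key _ h
    rw [hconst, hP, RingHom.mem_ker] at h'
    simp [Derivation.leibniz_pow, hc, hm, hη0] at h'
  · intro t ht
    rw [Polynomial.C_dvd_iff_dvd_coeff] at ht
    -- Primitivity: eliminating `y ^ m` from the two coefficients leaves a nonzero constant.
    have h1 : t ∣ C (a + b * c) := by
      have e : (C (a + b * c) : MvPolynomial (Fin 1) k) =
          C c * (C a * X 0 ^ m + C b) - C a * (C c * X 0 ^ m - 1) := by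
        simp only [map_add, map_mul]; ring
      rw [e]
      exact dvd_sub ((hlead ▸ ht n).mul_left _) ((hconst ▸ ht 0).mul_left _)
    exact isUnit_of_dvd_unit h1 ((isUnit_iff_ne_zero.2 habc).map C)
  · rw [hdeg]; omega

/-! ### Generators of the function field and their inverses -/

/-- Reversing the coefficients of a relation for `x⁻¹` gives a relation for `x`; the divisibility
found there is reversed back. -/
theorem dvd_of_eval₂_inv_eq_zero {R K : Type*} [CommRing R] [IsDomain R] [Field K] {i : R →+* K}
    {x : K} (hx : x ≠ 0) {A : R} (hA : A ≠ 0) (B : R) {n : ℕ} {G : Polynomial R}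
    (hG : G.eval₂ i x⁻¹ = 0)
    (h : ∀ H : Polynomial R, H.eval₂ i x = 0 →
      Polynomial.C A * Polynomial.X ^ n + Polynomial.C B ∣ H) :
    Polynomial.C B * Polynomial.X ^ n + Polynomial.C A ∣ G := by
  by_cases hG0 : G = 0
  · simp [hG0]
  let := invertibleOfNonzero (inv_ne_zero hx)
  obtain ⟨Q, hQ⟩ := h (Polynomial.reflect G.natDegree G) (by
    rw [← Polynomial.eval₂_reflect_eq_zero_iff i x⁻¹ G.natDegree G le_rfl, invOf_eq_inv,
      inv_inv] at hG
    exact hG)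
  have hdeg : (Polynomial.C A * Polynomial.X ^ n + Polynomial.C B).natDegree = n := by
    rw [Polynomial.natDegree_add_C, Polynomial.natDegree_C_mul_X_pow _ _ hA]
  have hne : Polynomial.reflect G.natDegree G ≠ 0 := by
    rwa [Ne, Polynomial.reflect_eq_zero_iff]
  -- This bound lets the reversal of the product split as a reversal of length `n` times one of
  -- length `G.natDegree - n`.
  have hle : n + Q.natDegree ≤ G.natDegree := by
    have := Polynomial.natDegree_reflect_le (N := G.natDegree) (p := G)
    rw [hQ] at hne
    rwa [max_self, hQ, Polynomial.natDegree_mul (left_ne_zero_of_mul hne)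
      (right_ne_zero_of_mul hne), hdeg] at this
  refine ⟨Polynomial.reflect (G.natDegree - n) Q, ?_⟩
  have h2 := congrArg (Polynomial.reflect G.natDegree) hQ
  obtain ⟨d, hd⟩ : ∃ d, G.natDegree = n + d := ⟨G.natDegree - n, by omega⟩
  rw [Polynomial.reflect_reflect, hd, Polynomial.reflect_mul _ _ hdeg.le (by omega)] at h2
  rw [hd, Nat.add_sub_cancel_left]
  conv_lhs => rw [h2]
  rw [Polynomial.reflect_add, Polynomial.reflect_C_mul_X_pow, Polynomial.reflect_C,
    Polynomial.revAt_le le_rfl, Nat.sub_self, pow_zero, mul_one, add_comm]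

section Model

variable {K : Type*} [Field K] [Algebra k K]

/-- The elements `x`, `y` generate `K` over `k`, and the polynomial relations between them are the
multiples of `curvePoly a b c n m`. -/
structure IsModel (a b c : k) (n m : ℕ) (x y : K) : Prop where
  ne_zero_left : x ≠ 0
  ne_zero_right : y ≠ 0
  aeval_eq_zero : aeval ![x, y] (curvePoly a b c n m) = 0
  dvd_of_aeval_eq_zero : ∀ F, aeval ![x, y] F = 0 → curvePoly a b c n m ∣ F
  adjoin_eq_top : IntermediateField.adjoin k {x, y} = ⊤

theorem rename_curvePoly (a b c : k) (n m : ℕ) :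
    rename (Equiv.swap 0 1) (curvePoly a b c n m) = curvePoly a c b m n := by
  simp only [curvePoly, map_sub, map_add, map_mul, map_pow, rename_C, rename_X, map_one,
    Equiv.swap_apply_left, Equiv.swap_apply_right]
  ring

theorem IsModel.swap {a b c : k} {n m : ℕ} {x y : K} (h : IsModel a b c n m x y) :
    IsModel a c b m n y x := by
  have e : ∀ F : MvPolynomial (Fin 2) k, aeval ![y, x] F =
      aeval ![x, y] (rename (Equiv.swap 0 1) F) := fun F => by
    rw [aeval_rename]
    congr 2
    ext i
    fin_cases i <;> simp
  have e2 : ∀ F : MvPolynomial (Fin 2) k,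
      rename (Equiv.swap 0 1) (rename (Equiv.swap 0 1) F) = F := fun F => by
    rw [rename_rename]
    convert rename_id_apply F
    ext i
    simp
  refine ⟨h.2, h.1, ?_, fun F hF => ?_, ?_⟩
  · rw [e, rename_curvePoly, h.3]
  · rw [e] at hF
    have := map_dvd (rename (R := k) (Equiv.swap (0 : Fin 2) 1)) (h.4 _ hF)
    rwa [e2, rename_curvePoly] at this
  · rw [Set.pair_comm, h.5]

theorem aeval_pair_eq_eval₂ (x y : K) (F : MvPolynomial (Fin 2) k) :
    aeval ![x, y] F =
      (finSuccEquiv k 1 F).eval₂ (aeval fun _ : Fin 1 => y : MvPolynomial (Fin 1) k →ₐ[k] K) x := by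
  induction F using MvPolynomial.induction_on with
  | C t => simp [finSuccEquiv_apply]
  | add p q hp hq => simp only [map_add, hp, hq, Polynomial.eval₂_add]
  | mul_X p i hp =>
    simp only [map_mul, hp, Polynomial.eval₂_mul, aeval_X]
    congr 1
    fin_cases i
    · simp [finSuccEquiv_X_zero]
    · have h1 : finSuccEquiv k 1 (X 1) = Polynomial.C (X 0) := finSuccEquiv_X_succ (j := 0)
      simp [h1]

/-- Multiplying the equation by `x⁻¹ ^ n` and dividing by `-b` restores the constant term `-1`.
Points with `x = ∞` thereby become affine points of a curve of the same family. -/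
theorem IsModel.inv {a b c : k} {n m : ℕ} {x y : K} (h : IsModel a b c n m x y)
    (hb : b ≠ 0) (hm : m ≠ 0) :
    IsModel (-c / b) (1 / b) (-a / b) n m x⁻¹ y := by
  have hx := h.1
  have hB : algebraMap k K b ≠ 0 := by simpa using hb
  refine ⟨inv_ne_zero h.1, h.2, ?_, fun F hF => ?_, ?_⟩
  · have := h.3
    rw [aeval_curvePoly] at this ⊢
    simp only [Matrix.cons_val_zero, Matrix.cons_val_one, map_div₀, map_neg, map_one, inv_pow]
      at this ⊢
    field_simp
    linear_combination -this
  · rw [aeval_pair_eq_eval₂] at hF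
    have key := dvd_of_eval₂_inv_eq_zero hx (coeff_lead_ne_zero a hb hm) (C c * X 0 ^ m - 1) hF
      (fun H hH => by
        rw [← finSuccEquiv_curvePoly, ← (finSuccEquiv k 1).apply_symm_apply H]
        refine map_dvd (finSuccEquiv k 1) (h.4 _ ?_)
        rwa [aeval_pair_eq_eval₂, AlgEquiv.apply_symm_apply])
    have e : Polynomial.C (C c * X 0 ^ m - 1) * Polynomial.X ^ n +
        Polynomial.C (C a * X 0 ^ m + C b) =
        Polynomial.C (C (-b)) * finSuccEquiv k 1 (curvePoly (-c / b) (1 / b) (-a / b) n m) := by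
      have e1 : (C (-b) * C (-c / b) : MvPolynomial (Fin 1) k) = C c := by
        rw [← C_mul]; congr 1; field_simp
      have e2 : (C (-b) * C (1 / b) : MvPolynomial (Fin 1) k) = -1 := by
        rw [← C_mul, ← C_1, ← C_neg]; congr 1; field_simp
      have e3 : (C (-b) * C (-a / b) : MvPolynomial (Fin 1) k) = C a := by
        rw [← C_mul]; congr 1; field_simp
      have e4 : (C (-b) : MvPolynomial (Fin 1) k) = - C b := map_neg C b
      rw [finSuccEquiv_curvePoly, mul_add, ← mul_assoc, ← Polynomial.C_mul, ← Polynomial.C_mul,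
        mul_add, ← mul_assoc, e1, e2, mul_sub, ← mul_assoc, e3, mul_one, e4, sub_neg_eq_add,
        sub_eq_add_neg]
    rw [e] at key
    have := map_dvd (finSuccEquiv k 1).symm (dvd_of_mul_left_dvd key)
    simpa using this
  · rw [← top_le_iff, ← h.5, IntermediateField.adjoin_le_iff]
    rintro z (rfl | rfl)
    · rw [← inv_inv z]
      exact inv_mem (IntermediateField.subset_adjoin _ _ (by simp))
    · exact IntermediateField.subset_adjoin _ _ (by simp)

end Model

/-! ### Rational places at smooth points -/

theorem mul_mem_nonunits {K : Type*} [Field K] {A : ValuationSubring K} {u v : K}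
    (hu : u ∈ A.nonunits) (hv : v ∈ A) : u * v ∈ A.nonunits := by
  rw [ValuationSubring.mem_nonunits_iff] at hu ⊢
  rw [← A.valuation_le_one_iff] at hv
  rw [map_mul]
  exact mul_lt_one_of_lt_of_le hu hv

theorem inv_mem_of_notMem_nonunits {K : Type*} [Field K] {A : ValuationSubring K} {u : K}
    (hu : u ∉ A.nonunits) : u⁻¹ ∈ A := by
  by_contra h
  exact hu (A.mem_nonunits_iff_or.2 (Or.inr h))

theorem algebraMap_notMem_nonunits {K : Type*} [Field K] [Algebra k K] {A : ValuationSubring K}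
    (hA : ∀ t : k, algebraMap k K t ∈ A) {t : k} (ht : t ≠ 0) :
    algebraMap k K t ∉ A.nonunits := fun h => by
  rw [ValuationSubring.mem_nonunits_iff_or, ← map_inv₀] at h
  exact h.elim (fun h => ht (by simpa using h)) fun h => h (hA _)

/-- The localization of `S` at `ker ε` is a Noetherian local domain whose maximal ideal is generated
by `τ`, hence a valuation ring. Any other place with the same centre dominates it, and a valuation
ring is maximal for domination. -/
theorem existsUnique_rationalPlace_of_isFractionRing {K S : Type*} [Field K] [Algebra k K]
    [CommRing S] [IsDomain S] [IsNoetherianRing S] [Algebra k S] [Algebra S K] [IsScalarTower k S K]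
    [IsFractionRing S K] (ε : S →ₐ[k] k) (τ : S) (hτ0 : τ ≠ 0) (hτ : ε τ = 0)
    (hprinc : ∀ F, ε F = 0 → ∃ H L, ε H ≠ 0 ∧ H * F = L * τ) :
    ∃! A : ValuationSubring K, IsRationalPlace k A ∧
      ∀ F, ε F = 0 → algebraMap S K F ∈ A.nonunits := by
  let P : Ideal S := RingHom.ker ε
  have : P.IsPrime := RingHom.ker_isPrime _
  have hmem : ∀ F, F ∈ P.primeCompl ↔ ε F ≠ 0 := fun F => Iff.rfl
  let R := Localization.subalgebra.ofField K P.primeCompl P.primeCompl_le_nonZeroDivisors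
  have : IsLocalization.AtPrime R P :=
    Localization.subalgebra.isLocalization_ofField K P.primeCompl P.primeCompl_le_nonZeroDivisors
  have : IsLocalRing R := IsLocalization.AtPrime.isLocalRing R P
  have : IsNoetherianRing R := IsLocalization.isNoetherianRing P.primeCompl R inferInstance
  have hunit : ∀ {H : S}, ε H ≠ 0 → IsUnit (algebraMap S R H) := fun hH =>
    IsLocalization.map_units R (⟨_, hH⟩ : P.primeCompl)
  have hmax : IsLocalRing.maximalIdeal R = Ideal.span {algebraMap S R τ} := by
    rw [← IsLocalization.AtPrime.map_eq_maximalIdeal P R]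
    apply le_antisymm
    · rw [Ideal.map_le_iff_le_comap]
      intro F hF
      obtain ⟨H, L, hH, e⟩ := hprinc F hF
      rw [Ideal.mem_comap, ← Ideal.unit_mul_mem_iff_mem _ (hunit hH), ← map_mul, e, map_mul]
      exact Ideal.mul_mem_left _ _ (Ideal.mem_span_singleton_self _)
    · rw [Ideal.span_singleton_le_iff_mem]
      exact Ideal.mem_map_of_mem _ hτ
  have hval : ValuationRing R :=
    ((tfae_of_isNoetherianRing_of_isLocalRing_of_isDomain R).out 4 1).1 (by
      rw [hmax]; exact ⟨_, rfl⟩)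
  let A : ValuationSubring K := ⟨R.toSubring, fun z => by
    rcases ValuationRing.isInteger_or_isInteger R z with ⟨u, hu⟩ | ⟨u, hu⟩
    · exact Or.inl (hu ▸ u.2)
    · exact Or.inr (hu ▸ u.2)⟩
  have hA : ∀ z : K, z ∈ A ↔ ∃ (F G : S) (_ : G ∈ P.primeCompl),
    z = algebraMap S K F * (algebraMap S K G)⁻¹ := fun z => Iff.rfl
  have hinj := IsFractionRing.injective S K
  have hne : ∀ {G : S}, ε G ≠ 0 → algebraMap S K G ≠ 0 := fun {G} hG h0 => by
    rw [map_eq_zero_iff _ hinj] at h0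
    simp [h0] at hG
  have hSA : ∀ F, algebraMap S K F ∈ A := fun F => (hA _).2 ⟨F, 1, by simp [hmem], by simp⟩
  have hnon : ∀ F, ε F = 0 → algebraMap S K F ∈ A.nonunits := fun F hF => by
    rw [ValuationSubring.mem_nonunits_iff_or]
    by_contra! hcon
    obtain ⟨h0, F', G, hG, e⟩ := hcon
    have hG0 := hne hG
    have : G = F' * F := by
      apply hinj
      rw [map_mul]
      field_simp at e
      rw [e]; ring
    exact (hmem G).1 hG (by rw [this, map_mul, hF, mul_zero])
  have hconst : ∀ t : k, algebraMap k K t = algebraMap S K (algebraMap k S t) := fun t =>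
    IsScalarTower.algebraMap_apply k S K t
  refine ⟨A, ⟨⟨?_, fun t => ?_, ?_⟩, hnon⟩, ?_⟩
  · intro htop
    have h1 := hnon τ hτ
    rw [ValuationSubring.mem_nonunits_iff_or, htop] at h1
    simp [hτ0] at h1
  · rw [hconst]; exact hSA _
  · rintro u ⟨F, G, hG, rfl⟩
    refine ⟨ε F / ε G, ?_⟩
    have e : algebraMap S K F * (algebraMap S K G)⁻¹ - algebraMap k K (ε F / ε G) =
        algebraMap S K (F - algebraMap k S (ε F / ε G) * G) * (algebraMap S K G)⁻¹ := by
      have := hne hG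
      rw [hconst, map_sub, map_mul]
      field_simp
    rw [e]
    refine mul_mem_nonunits (hnon _ ?_) ((hA _).2 ⟨1, G, hG, by simp⟩)
    have : ε G ≠ 0 := hG
    simp [this]
  · rintro A' ⟨⟨-, hk, -⟩, hA'⟩
    have hS' : ∀ F, algebraMap S K F ∈ A' := fun F => by
      have h1 := A'.nonunits_le (hA' (F - algebraMap k S (ε F)) (by simp))
      have h2 := A'.add_mem _ _ h1 (hk (ε F))
      rwa [hconst, ← map_add, sub_add_cancel] at h2
    have hinv : ∀ {G}, ε G ≠ 0 → (algebraMap S K G)⁻¹ ∈ A' := fun {G} hG => by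
      refine inv_mem_of_notMem_nonunits fun h => algebraMap_notMem_nonunits hk hG ?_
      have h1 := hA' (G - algebraMap k S (ε G)) (by simp)
      have h2 := A'.nonunits.sub_mem h h1
      rwa [← map_sub, sub_sub_cancel, ← hconst] at h2
    apply le_antisymm
    -- If `u` is not in `A`, then `u⁻¹` is in the maximal ideal of `A`, hence in that of `A'`, so
    -- `u` is not in `A'`.
    · intro u hu
      by_contra huA
      have hu0 : u ≠ 0 := by
        rintro rfl
        exact huA A.zero_mem
      obtain ⟨F, G, hG, e⟩ := (hA _).1 ((A.mem_or_inv_mem u).resolve_left huA)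
      have hF : ε F = 0 := by
        by_contra hF
        refine huA ((hA _).2 ⟨G, F, hF, ?_⟩)
        rw [← inv_inv u, e, mul_inv_rev, inv_inv]
      have h1 : u⁻¹ ∈ A'.nonunits := e ▸ mul_mem_nonunits (hA' F hF) (hinv hG)
      rw [ValuationSubring.inv_mem_nonunits_iff] at h1
      exact h1.elim hu0 fun h => h hu
    · rintro u hu
      obtain ⟨F, G, hG, rfl⟩ := (hA _).1 hu
      exact A'.mul_mem _ _ (hS' F) (hinv hG)

theorem aeval_pair_mem {K : Type*} [Field K] [Algebra k K] {A : ValuationSubring K}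
    (hA : ∀ t : k, algebraMap k K t ∈ A) {x y : K} (hx : x ∈ A) (hy : y ∈ A)
    (F : MvPolynomial (Fin 2) k) : aeval ![x, y] F ∈ A := by
  induction F using MvPolynomial.induction_on with
  | C t => simpa using hA t
  | add p q hp hq => simpa using A.add_mem _ _ hp hq
  | mul_X p i hp =>
    rw [map_mul, aeval_X]
    refine A.mul_mem _ _ hp ?_
    fin_cases i
    · exact hx
    · exact hy

theorem exists_sub_C_eval_eq (P : Fin 2 → k) (F : MvPolynomial (Fin 2) k) :
    ∃ F₁ F₂, F - C (eval P F) = F₁ * (X 0 - C (P 0)) + F₂ * (X 1 - C (P 1)) := by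
  let I : Ideal (MvPolynomial (Fin 2) k) := Ideal.span {X 0 - C (P 0), X 1 - C (P 1)}
  have hI : (Ideal.Quotient.mkₐ k I) =
      (Algebra.ofId k (MvPolynomial (Fin 2) k ⧸ I)).comp (aeval P) := by
    ext i
    rw [AlgHom.comp_apply, aeval_X]
    refine Ideal.Quotient.eq.2 (Ideal.subset_span ?_)
    fin_cases i <;> simp [algebraMap_eq]
  have : F - C (eval P F) ∈ I := by
    rw [← Ideal.Quotient.eq]
    exact (DFunLike.congr_fun hI F)
  obtain ⟨u, v, e⟩ := Ideal.mem_span_pair.1 this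
  exact ⟨u, v, e.symm⟩

/-- The hypotheses say that `∂g/∂y = m y ^ (m - 1) (a x ^ n + c)` is nonzero at the point, so `x -
x₀` is a uniformizer there. -/
theorem existsUnique_rationalPlace_of_deriv_right {K : Type*} [Field K] [Algebra k K] {a b c : k}
    {n m : ℕ} {x y : K} (h : IsModel a b c n m x y) (hg : Irreducible (curvePoly a b c n m))
    {x₀ y₀ : k} (h₀ : eval ![x₀, y₀] (curvePoly a b c n m) = 0)
    (hd : a * x₀ ^ n + c ≠ 0) (hm : (m : k) ≠ 0) (hy₀ : y₀ ≠ 0) :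
    ∃! A : ValuationSubring K, IsRationalPlace k A ∧ x - algebraMap k K x₀ ∈ A.nonunits ∧
      y - algebraMap k K y₀ ∈ A.nonunits := by
  set g := curvePoly a b c n m with hgdef
  have := isDomain_coordRing hg
  have hker : ∀ F ∈ Ideal.span {g}, aeval ![x, y] F = 0 := fun F hF => by
    obtain ⟨u, rfl⟩ := Ideal.mem_span_singleton.1 hF
    rw [map_mul, h.aeval_eq_zero, zero_mul]
  have hker₀ : ∀ F ∈ Ideal.span {g}, aeval ![x₀, y₀] F = 0 := fun F hF => by
    obtain ⟨u, rfl⟩ := Ideal.mem_span_singleton.1 hF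
    rw [map_mul, aeval_eq_eval, h₀, zero_mul]
  let φ : CoordRing g →ₐ[k] K := Ideal.Quotient.liftₐ _ (aeval ![x, y]) hker
  let ε : CoordRing g →ₐ[k] k := Ideal.Quotient.liftₐ _ (aeval ![x₀, y₀]) hker₀
  let mk : MvPolynomial (Fin 2) k →ₐ[k] CoordRing g := Ideal.Quotient.mkₐ k _
  have hmk : Function.Surjective mk := Ideal.Quotient.mk_surjective
  have hφ : ∀ F, φ (mk F) = aeval ![x, y] F := fun F => rfl
  have hε : ∀ F, ε (mk F) = eval ![x₀, y₀] F := fun F => rfl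
  have hφinj : Function.Injective φ := by
    rw [injective_iff_map_eq_zero]
    intro u hu
    obtain ⟨F, rfl⟩ := hmk u
    exact Ideal.Quotient.eq_zero_iff_mem.2
      (Ideal.mem_span_singleton.2 (h.dvd_of_aeval_eq_zero F hu))
  let _ : Algebra (CoordRing g) K := φ.toAlgebra
  have : IsScalarTower k (CoordRing g) K := IsScalarTower.of_algebraMap_eq fun t =>
    (φ.commutes t).symm
  have : FaithfulSMul (CoordRing g) K := (faithfulSMul_iff_algebraMap_injective _ _).2 hφinj
  have : IsFractionRing (CoordRing g) K := IsFractionRing.of_field _ _ fun z => by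
    have hz : z ∈ IntermediateField.adjoin k (Set.range ![x, y]) := by
      rw [Matrix.range_cons, Matrix.range_cons, Matrix.range_empty, Set.union_empty,
        Set.singleton_union, h.adjoin_eq_top]
      trivial
    obtain ⟨F, G, e⟩ := (IntermediateField.mem_adjoin_range_iff _ _ _).1 hz
    exact ⟨mk F, mk G, e⟩
  have hlin : ∀ F : MvPolynomial (Fin 2) k, eval ![x₀, y₀] F = 0 →
      ∃ F₁ F₂, F = F₁ * (X 0 - C x₀) + F₂ * (X 1 - C y₀) := fun F hF => by
    simpa [hF] using exists_sub_C_eval_eq ![x₀, y₀] F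
  -- Difference quotients of `x ^ n` and `y ^ m`. They yield `g = H₀ (y - y₀) - L₀ (x - x₀)`, where
  -- `H₀` takes the value `∂g/∂y` at the point.
  let Gx : MvPolynomial (Fin 2) k := ∑ i ∈ Finset.range n, X 0 ^ i * C x₀ ^ (n - 1 - i)
  let Gy : MvPolynomial (Fin 2) k := ∑ i ∈ Finset.range m, X 1 ^ i * C y₀ ^ (m - 1 - i)
  have hGx : Gx * (X 0 - C x₀) = X 0 ^ n - C x₀ ^ n := geom_sum₂_mul _ _ _
  have hGy : Gy * (X 1 - C y₀) = X 1 ^ m - C y₀ ^ m := geom_sum₂_mul _ _ _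
  let H₀ : MvPolynomial (Fin 2) k := (C a * X 0 ^ n + C c) * Gy
  let L₀ : MvPolynomial (Fin 2) k := -(C a * C y₀ ^ m + C b) * Gx
  have hH₀ : eval ![x₀, y₀] H₀ ≠ 0 := by
    have : eval ![x₀, y₀] Gy = m * y₀ ^ (m - 1) := by
      simp only [Gy, map_sum, map_mul, map_pow, eval_X, eval_C, Matrix.cons_val_one]
      exact geom_sum₂_self y₀ m
    simp only [H₀, map_mul, this]
    simp [hd, hm, hy₀]
  have hrel : H₀ * (X 1 - C y₀) - L₀ * (X 0 - C x₀) = g := by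
    have e : (C a * C x₀ ^ n * C y₀ ^ m + C b * C x₀ ^ n + C c * C y₀ ^ m - 1 :
        MvPolynomial (Fin 2) k) = 0 := by
      rw [eval_curvePoly] at h₀
      simp only [← C_pow, ← C_mul, ← C_add, ← C_1, ← C_sub]
      rw [← C_0]
      exact congrArg C h₀
    simp only [hgdef, curvePoly, H₀, L₀]
    linear_combination (C a * X 0 ^ n + C c) * hGy + (C a * C y₀ ^ m + C b) * hGx - e
  have hmkg : mk g = 0 := Ideal.Quotient.eq_zero_iff_mem.2 (Ideal.mem_span_singleton_self g)
  have key := existsUnique_rationalPlace_of_isFractionRing (K := K) ε (mk (X 0 - C x₀)) ?_ ?_ ?_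
  · refine (existsUnique_congr fun A => and_congr_right fun hA => ?_).1 key
    constructor
    · intro hF
      have h1 := hF (mk (X 0 - C x₀)) (by simp [hε])
      have h2 := hF (mk (X 1 - C y₀)) (by simp [hε])
      change aeval ![x, y] _ ∈ _ at h1
      change aeval ![x, y] _ ∈ _ at h2
      simpa using And.intro h1 h2
    · rintro ⟨h1, h2⟩ u hu
      obtain ⟨F, rfl⟩ := hmk u
      have hmem := aeval_pair_mem hA.2.1 (x := x) (y := y)
        (by simpa using A.add_mem _ _ (A.nonunits_le h1) (hA.2.1 x₀))
        (by simpa using A.add_mem _ _ (A.nonunits_le h2) (hA.2.1 y₀))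
      obtain ⟨F₁, F₂, rfl⟩ := hlin F hu
      change aeval ![x, y] _ ∈ _
      rw [map_add, map_mul, map_mul, mul_comm, mul_comm (aeval _ F₂)]
      refine A.nonunits.add_mem (mul_mem_nonunits ?_ (hmem _)) (mul_mem_nonunits ?_ (hmem _))
      · simpa using h1
      · simpa using h2
  -- If `g` divided `x - x₀`, the two would be associated and `g` would vanish identically at `x =
  -- x₀`; comparing `y = 0` with `y = 1` contradicts `hd`.
  · intro h0
    have hdvd : g ∣ X 0 - C x₀ := Ideal.mem_span_singleton.1 (Ideal.Quotient.eq_zero_iff_mem.1 h0)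
    have hC : finSuccEquiv k 1 (C x₀) = Polynomial.C (C x₀) := by simp [finSuccEquiv_apply]
    replace hdvd := map_dvd (finSuccEquiv k 1) hdvd
    rw [map_sub, finSuccEquiv_X_zero, hC] at hdvd
    have hirr := (MulEquiv.irreducible_iff (finSuccEquiv k 1)).2 hg
    have hroot := (hirr.dvd_symm (Polynomial.prime_X_sub_C (C x₀)).irreducible hdvd)
    rw [Polynomial.dvd_iff_isRoot, hgdef, finSuccEquiv_curvePoly] at hroot
    have e₀ := congrArg (eval 0) hroot.eq_zero
    have e₁ := congrArg (eval 1) hroot.eq_zero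
    have hm0 : m ≠ 0 := by rintro rfl; simp at hm
    simp [hm0] at e₀ e₁
    exact hd (by linear_combination e₁ - e₀)
  · simp [hε]
  · intro u hu
    obtain ⟨F, rfl⟩ := hmk u
    obtain ⟨F₁, F₂, rfl⟩ := hlin F hu
    refine ⟨mk H₀, mk (H₀ * F₁ + F₂ * L₀), hH₀, ?_⟩
    rw [← map_mul, ← map_mul, ← sub_eq_zero, ← map_sub]
    have e : H₀ * (F₁ * (X 0 - C x₀) + F₂ * (X 1 - C y₀)) -
        (H₀ * F₁ + F₂ * L₀) * (X 0 - C x₀) = F₂ * g := by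
      rw [← hrel]; ring
    rw [e, map_mul, hmkg, mul_zero]

/-- On the curve `(a x ^ n + c) (a y ^ m + b) = a + b c ≠ 0`, and the origin is not on it, so at
least one partial derivative is nonzero at each point. -/
theorem existsUnique_rationalPlace {K : Type*} [Field K] [Algebra k K] {a b c : k} {n m : ℕ}
    {x y : K} (h : IsModel a b c n m x y) (hg : Irreducible (curvePoly a b c n m)) (hb : b ≠ 0)
    (hc : c ≠ 0) (habc : a + b * c ≠ 0) (hn : (n : k) ≠ 0) (hm : (m : k) ≠ 0) {x₀ y₀ : k}
    (h₀ : eval ![x₀, y₀] (curvePoly a b c n m) = 0) :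
    ∃! A : ValuationSubring K, IsRationalPlace k A ∧ x - algebraMap k K x₀ ∈ A.nonunits ∧
      y - algebraMap k K y₀ ∈ A.nonunits := by
  have hn0 : n ≠ 0 := by rintro rfl; simp at hn
  have hm0 : m ≠ 0 := by rintro rfl; simp at hm
  have e := h₀
  simp only [eval_curvePoly, Matrix.cons_val_zero, Matrix.cons_val_one] at e
  by_cases hd : a * x₀ ^ n + c ≠ 0 ∧ y₀ ≠ 0
  · exact existsUnique_rationalPlace_of_deriv_right h hg h₀ hd.1 hm hd.2
  have hg' : Irreducible (curvePoly a c b m n) := by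
    rw [← rename_curvePoly]
    exact (MulEquiv.irreducible_iff (renameEquiv k (Equiv.swap (0 : Fin 2) 1))).2 hg
  have key := existsUnique_rationalPlace_of_deriv_right h.swap hg' (x₀ := y₀) (y₀ := x₀)
    (by simp only [eval_curvePoly, Matrix.cons_val_zero, Matrix.cons_val_one]
        linear_combination e)
    (fun h0 => hd ⟨fun h1 => habc ?_, ?_⟩) hn ?_
  · simpa only [and_comm (a := y - algebraMap k K y₀ ∈ _)] using key
  · linear_combination (-a) * e + (a * y₀ ^ m + b) * h1
  · rintro rfl
    simp [hm0, hb] at h0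
  · rintro rfl
    apply hd
    simp only [hn0, zero_pow, ne_eq, not_false_eq_true, mul_zero, zero_add, zero_mul] at e ⊢
    refine ⟨hc, ?_⟩
    rintro rfl
    simp [hm0] at e

/-! ### Places as points of the product of two projective lines -/

section Residue

variable {K : Type*} [Field K] [Algebra k K]

/-- The element `z` has residue `o` at the place `A`, where `none` stands for infinity. -/
def HasResidue (A : ValuationSubring K) (z : K) : Option k → Prop
  | some t => z - algebraMap k K t ∈ A.nonunits
  | none => z⁻¹ ∈ A.nonunits

theorem hasResidue_none_iff {A : ValuationSubring K} {z : K} :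
    HasResidue A z (none : Option k) ↔ HasResidue A z⁻¹ (some (0 : k)) := by
  simp [HasResidue]

theorem IsRationalPlace.exists_hasResidue {A : ValuationSubring K} (hA : IsRationalPlace k A)
    (z : K) : ∃ o : Option k, HasResidue A z o := by
  by_cases hz : z ∈ A
  · obtain ⟨t, ht⟩ := hA.2.2 z hz
    exact ⟨some t, ht⟩
  · exact ⟨none, A.inv_mem_nonunits_iff.2 (Or.inr hz)⟩

/-- The case `z = 0` is excluded because `0⁻¹ = 0` would give it both residues `0` and infinity. -/
theorem IsRationalPlace.hasResidue_unique {A : ValuationSubring K} (hA : IsRationalPlace k A)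
    {z : K} (hz : z ≠ 0) {o o' : Option k} (h : HasResidue A z o) (h' : HasResidue A z o') :
    o = o' := by
  have key : ∀ t : k, HasResidue A z (some t) → ¬ HasResidue A z (none : Option k) := by
    intro t ht hn
    have h1 := A.add_mem _ _ (A.nonunits_le ht) (hA.2.1 t)
    rw [sub_add_cancel] at h1
    exact (A.inv_mem_nonunits_iff.1 hn).elim hz fun h => h h1
  match o, o', h, h' with
  | none, none, _, _ => rfl
  | none, some t, h, h' => exact absurd h (key t h')
  | some t, none, h, h' => exact absurd h' (key t h)
  | some t, some t', h, h' =>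
    congr 1
    by_contra hne
    refine algebraMap_notMem_nonunits hA.2.1 (sub_ne_zero.2 hne) ?_
    have := A.nonunits.sub_mem h' h
    rw [map_sub]
    convert this using 1
    ring

theorem IsRationalPlace.eval_eq_zero {A : ValuationSubring K} (hA : IsRationalPlace k A) {x y : K}
    {x₀ y₀ : k} (hx : HasResidue A x (some x₀)) (hy : HasResidue A y (some y₀))
    {F : MvPolynomial (Fin 2) k} (hF : aeval ![x, y] F = 0) : eval ![x₀, y₀] F = 0 := by
  have hmem := aeval_pair_mem hA.2.1 (x := x) (y := y)
    (by simpa using A.add_mem _ _ (A.nonunits_le hx) (hA.2.1 x₀))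
    (by simpa using A.add_mem _ _ (A.nonunits_le hy) (hA.2.1 y₀))
  obtain ⟨F₁, F₂, e⟩ := exists_sub_C_eval_eq ![x₀, y₀] F
  by_contra hne
  refine algebraMap_notMem_nonunits hA.2.1 hne ?_
  have e' := congrArg (aeval ![x, y]) e
  simp only [map_sub, hF, aeval_C, map_add, map_mul, aeval_X, Matrix.cons_val_zero,
    Matrix.cons_val_one, zero_sub] at e'
  rw [← neg_neg (algebraMap k K _), e', mul_comm, mul_comm (aeval _ F₂)]
  exact A.nonunits.neg_mem (A.nonunits.add_mem (mul_mem_nonunits hx (hmem _))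
    (mul_mem_nonunits hy (hmem _)))

end Residue

/-- The points of the closure of the affine curve `a x^n y^m + b x^n + c y^m = 1` in the product of
two projective lines, where `none` stands for infinity. -/
def OnCurve (a b c : k) (n m : ℕ) : Option k → Option k → Prop
  | some x, some y => eval ![x, y] (curvePoly a b c n m) = 0
  | none, some y => a * y ^ m + b = 0
  | some x, none => a * x ^ n + c = 0
  | none, none => False

section Points

variable {K : Type*} [Field K] [Algebra k K] {a b c : k} {n m : ℕ} {x y : K}

theorem IsModel.irreducible (h : IsModel a b c n m x y) (hn : n ≠ 0) (hm : m ≠ 0) :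
    Irreducible (curvePoly a b c n m) := by
  have hne : curvePoly a b c n m ≠ 0 := fun h0 => by
    have := congrArg (eval ![0, 0]) h0
    simp [eval_curvePoly, hn, hm] at this
  refine Prime.irreducible ((Ideal.span_singleton_prime hne).1 ?_)
  have e : Ideal.span {curvePoly a b c n m} =
      RingHom.ker (aeval ![x, y] : MvPolynomial (Fin 2) k →ₐ[k] K) := ?_
  · rw [e]
    exact RingHom.ker_isPrime _
  refine Ideal.ext fun F => ?_
  rw [Ideal.mem_span_singleton, RingHom.mem_ker]
  refine ⟨?_, h.dvd_of_aeval_eq_zero F⟩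
  rintro ⟨u, rfl⟩
  rw [map_mul, h.aeval_eq_zero, zero_mul]

theorem IsModel.existsUnique_rationalPlace_iff (h : IsModel a b c n m x y)
    (hn0 : n ≠ 0) (hm0 : m ≠ 0) (hb : b ≠ 0) (hc : c ≠ 0) (habc : a + b * c ≠ 0)
    (hn : (n : k) ≠ 0) (hm : (m : k) ≠ 0) (x₀ y₀ : k) :
    (eval ![x₀, y₀] (curvePoly a b c n m) = 0 → ∃! A : ValuationSubring K,
      IsRationalPlace k A ∧ HasResidue A x (some x₀) ∧ HasResidue A y (some y₀)) ∧
    (∀ A : ValuationSubring K, IsRationalPlace k A → HasResidue A x (some x₀) →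
      HasResidue A y (some y₀) → eval ![x₀, y₀] (curvePoly a b c n m) = 0) :=
  ⟨fun h₀ => existsUnique_rationalPlace h (h.irreducible hn0 hm0) hb hc habc hn hm h₀,
    fun _ hA hx hy => hA.eval_eq_zero hx hy h.aeval_eq_zero⟩

/-- One affine chart for each choice of inverting `x` or `y`; up to sign and a square, `a + b c` is
unchanged when one coordinate is inverted, so smoothness carries over. -/
theorem IsModel.hasResidue_onCurve (h : IsModel a b c n m x y) (ha : a ≠ 0) (hb : b ≠ 0)
    (hc : c ≠ 0) (habc : a + b * c ≠ 0) (hn : (n : k) ≠ 0) (hm : (m : k) ≠ 0)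
    (o₁ o₂ : Option k) :
    (OnCurve a b c n m o₁ o₂ → ∃! A : ValuationSubring K,
      IsRationalPlace k A ∧ HasResidue A x o₁ ∧ HasResidue A y o₂) ∧
    (∀ A : ValuationSubring K, IsRationalPlace k A → HasResidue A x o₁ →
      HasResidue A y o₂ → OnCurve a b c n m o₁ o₂) := by
  have hn0 : n ≠ 0 := by rintro rfl; simp at hn
  have hm0 : m ≠ 0 := by rintro rfl; simp at hm
  have hx := h.inv hb hm0
  have hy := (h.swap.inv hc hn0).swap
  have hxy := (hx.swap.inv (div_ne_zero (neg_ne_zero.2 ha) hb) hn0).swap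
  match o₁, o₂ with
  | some x₀, some y₀ =>
    exact h.existsUnique_rationalPlace_iff hn0 hm0 hb hc habc hn hm x₀ y₀
  | none, some y₀ =>
    simp only [hasResidue_none_iff, OnCurve]
    have e : a * y₀ ^ m + b = 0 ↔
        eval ![0, y₀] (curvePoly (-c / b) (1 / b) (-a / b) n m) = 0 := by
      simp only [eval_curvePoly, Matrix.cons_val_zero, Matrix.cons_val_one]
      field_simp
      simp only [ne_eq, hn0, not_false_eq_true, zero_pow, mul_zero]
      constructor <;> intro h <;> linear_combination -h
    rw [e]
    refine hx.existsUnique_rationalPlace_iff hn0 hm0 (by simp [hb]) (by simp [ha, hb]) ?_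
      hn hm 0 y₀
    intro h0
    field_simp at h0
    exact habc (by linear_combination -h0)
  | some x₀, none =>
    simp only [hasResidue_none_iff, OnCurve]
    have e : a * x₀ ^ n + c = 0 ↔
        eval ![x₀, 0] (curvePoly (-b / c) (-a / c) (1 / c) n m) = 0 := by
      simp only [eval_curvePoly, Matrix.cons_val_zero, Matrix.cons_val_one]
      field_simp
      simp only [ne_eq, hm0, not_false_eq_true, zero_pow, mul_zero]
      constructor <;> intro h <;> linear_combination -h
    rw [e]
    refine hy.existsUnique_rationalPlace_iff hn0 hm0 (by simp [ha, hc]) (by simp [hc]) ?_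
      hn hm x₀ 0
    intro h0
    field_simp at h0
    exact habc (by linear_combination -h0)
  | none, none =>
    simp only [hasResidue_none_iff, OnCurve, IsEmpty.forall_iff, true_and]
    -- In the coordinates `x⁻¹`, `y⁻¹` the equation still has constant term `-1`, so the corner is
    -- off the curve.
    intro A hA h1 h2
    have := hA.eval_eq_zero h1 h2 hxy.aeval_eq_zero
    simp [eval_curvePoly, hn0, hm0] at this

theorem IsModel.card_rationalPlace (h : IsModel a b c n m x y) (ha : a ≠ 0) (hb : b ≠ 0)
    (hc : c ≠ 0) (habc : a + b * c ≠ 0) (hn : (n : k) ≠ 0) (hm : (m : k) ≠ 0) :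
    Nat.card {A : ValuationSubring K // IsRationalPlace k A} =
      Nat.card {o : Option k × Option k // OnCurve a b c n m o.1 o.2} := by
  have key := h.hasResidue_onCurve ha hb hc habc hn hm
  choose f hf using fun o : {o : Option k × Option k // OnCurve a b c n m o.1 o.2} =>
    (key o.1.1 o.1.2).1 o.2
  refine (Nat.card_congr (Equiv.ofBijective (fun o => ⟨f o, (hf o).1.1⟩) ⟨?_, ?_⟩)).symm
  · rintro o o' hoo
    replace hoo : f o = f o' := congrArg Subtype.val hoo
    have h1 := (hf o).1
    have h2 := (hf o').1
    rw [← hoo] at h2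
    exact Subtype.ext (Prod.ext (h1.1.hasResidue_unique h.ne_zero_left h1.2.1 h2.2.1)
      (h1.1.hasResidue_unique h.ne_zero_right h1.2.2 h2.2.2))
  · rintro ⟨A, hA⟩
    obtain ⟨o₁, h₁⟩ := hA.exists_hasResidue (k := k) x
    obtain ⟨o₂, h₂⟩ := hA.exists_hasResidue (k := k) y
    exact ⟨⟨(o₁, o₂), (key o₁ o₂).2 A hA h₁ h₂⟩,
      Subtype.ext ((hf ⟨(o₁, o₂), (key o₁ o₂).2 A hA h₁ h₂⟩).2 A ⟨hA, h₁, h₂⟩).symm⟩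

end Points

theorem isModel_fractionRing {a b c : k} {n m : ℕ} (hf : Irreducible (curvePoly a b c n m))
    (hn : n ≠ 0) (hm : m ≠ 0) :
    haveI := isDomain_coordRing hf
    IsModel (K := FractionRing (CoordRing (curvePoly a b c n m))) a b c n m
      (algebraMap (CoordRing (curvePoly a b c n m)) _ (Ideal.Quotient.mk _ (X 0)))
      (algebraMap (CoordRing (curvePoly a b c n m)) _ (Ideal.Quotient.mk _ (X 1))) := by
  have := isDomain_coordRing hf
  set g := curvePoly a b c n m with hg
  set x := (algebraMap (CoordRing g) (FractionRing (CoordRing g)) (Ideal.Quotient.mk _ (X 0)))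
    with hx
  set y := (algebraMap (CoordRing g) (FractionRing (CoordRing g)) (Ideal.Quotient.mk _ (X 1)))
    with hy
  have hφ : ∀ F, aeval ![x, y] F = algebraMap (CoordRing g) (FractionRing (CoordRing g))
      (Ideal.Quotient.mk _ F) := fun F => by
    induction F using MvPolynomial.induction_on with
    | C t =>
      rw [aeval_C, IsScalarTower.algebraMap_apply k (CoordRing g)]
      rfl
    | add p q hp hq => simp only [map_add, hp, hq]
    | mul_X p i hp =>
      simp only [map_mul, hp, aeval_X]
      congr 1
      fin_cases i <;> simp [x, y]
  have hzero : ∀ F, aeval ![x, y] F = 0 ↔ g ∣ F := fun F => by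
    rw [hφ, map_eq_zero_iff _ (IsFractionRing.injective _ _), Ideal.Quotient.eq_zero_iff_mem,
      Ideal.mem_span_singleton]
  have hX : ∀ i : Fin 2, ¬ g ∣ X i := fun i h => by
    obtain ⟨u, hu⟩ := hf.dvd_symm (X_prime (R := k) (i := i)).irreducible h
    have := congrArg (eval ![0, 0]) hu
    rw [eval_curvePoly] at this
    fin_cases i <;> simp [hn, hm] at this
  refine ⟨fun h => hX 0 ((hzero _).1 ?_), fun h => hX 1 ((hzero _).1 ?_), (hzero _).2 dvd_rfl,
    fun F => (hzero F).1, ?_⟩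
  · simpa using h
  · simpa using h
  · rw [eq_top_iff]
    intro z _
    obtain ⟨u, v, -, rfl⟩ := IsFractionRing.div_surjective (CoordRing g) z
    obtain ⟨F, rfl⟩ := Ideal.Quotient.mk_surjective u
    obtain ⟨G, rfl⟩ := Ideal.Quotient.mk_surjective v
    have : ({x, y} : Set _) = Set.range ![x, y] := by
      rw [Matrix.range_cons, Matrix.range_cons, Matrix.range_empty, Set.union_empty,
        Set.singleton_union]
    rw [this, IntermediateField.mem_adjoin_range_iff]
    exact ⟨F, G, by rw [hφ, hφ]⟩

/-! ### Counting points over a finite field -/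

/-- The unit group is cyclic of order `N N'`, so the `N`-th powers, contained in the `N'`-torsion,
fill it by cardinality, and each nonempty fibre is a coset of the `N`-torsion. -/
theorem card_pow_eq {F : Type*} [Field F] [Finite F] {N N' : ℕ} (hN : N * N' = Nat.card F - 1)
    {d : F} (hd : d ≠ 0) :
    ((∃ z : F, z ^ N = d) ↔ d ^ N' = 1) ∧ (d ^ N' = 1 → Nat.card {t : F // t ^ N = d} = N) := by
  have hcard : Nat.card Fˣ = N * N' := by rw [Nat.card_units, hN]
  have hpos : 0 < N * N' := hcard ▸ Nat.card_pos
  have hN0 : 0 < N := Nat.pos_of_mul_pos_right hpos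
  have hN0' : 0 < N' := Nat.pos_of_mul_pos_left hpos
  have hker : Nat.card (powMonoidHom N : Fˣ →* Fˣ).ker = N := by
    rw [IsCyclic.card_powMonoidHom_ker, hcard, Nat.gcd_mul_right_left]
  have hrange : (powMonoidHom N : Fˣ →* Fˣ).range = (powMonoidHom N' : Fˣ →* Fˣ).ker := by
    apply Subgroup.eq_of_le_of_card_ge
    · rintro _ ⟨u, rfl⟩
      rw [MonoidHom.mem_ker, powMonoidHom_apply, powMonoidHom_apply, ← pow_mul, ← hcard]
      exact pow_card_eq_one'
    · rw [IsCyclic.card_powMonoidHom_ker, IsCyclic.card_powMonoidHom_range, hcard,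
        Nat.gcd_mul_right_left, Nat.gcd_mul_left_left, Nat.mul_div_cancel_left _ hN0]
  have hiff : (∃ z : F, z ^ N = d) ↔ d ^ N' = 1 := by
    constructor
    · rintro ⟨z, rfl⟩
      have hz : z ≠ 0 := by
        rintro rfl
        simp [hN0.ne'] at hd
      have := pow_card_eq_one' (x := Units.mk0 z hz)
      rw [hcard] at this
      simpa [Units.ext_iff, pow_mul] using this
    · intro h
      have : Units.mk0 d hd ∈ (powMonoidHom N : Fˣ →* Fˣ).range := by
        rw [hrange, MonoidHom.mem_ker, powMonoidHom_apply]
        ext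
        simpa using h
      obtain ⟨u, hu⟩ := this
      exact ⟨u, by simpa using congrArg Units.val hu⟩
  refine ⟨hiff, fun h => ?_⟩
  obtain ⟨z, rfl⟩ := hiff.2 h
  have hz : z ≠ 0 := by
    rintro rfl
    simp [hN0.ne'] at hd
  have hmap : ∀ u : (powMonoidHom N : Fˣ →* Fˣ).ker, (z * (u.1 : Fˣ)) ^ N = z ^ N := fun u => by
    have := congrArg Units.val u.2
    simp only [powMonoidHom_apply, Units.val_pow_eq_pow_val, Units.val_one] at this
    rw [mul_pow, this, mul_one]
  refine Eq.trans (Nat.card_congr (Equiv.ofBijective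
    (fun u : (powMonoidHom N : Fˣ →* Fˣ).ker => ⟨z * (u.1 : Fˣ), hmap u⟩) ⟨?_, ?_⟩)).symm hker
  · intro u v huv
    have := congrArg Subtype.val huv
    exact Subtype.ext (Units.ext (mul_left_cancel₀ hz this))
  · rintro ⟨t, ht⟩
    have ht0 : t ≠ 0 := by
      rintro rfl
      rw [zero_pow hN0.ne'] at ht
      exact hd ht.symm
    refine ⟨⟨Units.mk0 (t / z) (div_ne_zero ht0 hz), ?_⟩, Subtype.ext ?_⟩
    · rw [MonoidHom.mem_ker]
      ext
      simp [div_pow, ht, hd]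
    · simp [mul_div_cancel₀ _ hz]

/-- The map `(x, y) ↦ (x ^ N, y ^ M)` has all fibres of size `N M`. What remains depends on the
field only through `N'` and `M'`, which agree for the two curves to be compared. -/
theorem numTorusPoints_curvePoly {F : Type*} [Field F] [Finite F] {N N' M M' : ℕ}
    (hN : N * N' = Nat.card F - 1) (hM : M * M' = Nat.card F - 1) (a b c : F) :
    numTorusPoints (curvePoly a b c N M) = N * M *
      Nat.card {P : F × F // P.1 ^ N' = 1 ∧ P.2 ^ M' = 1 ∧
        a * P.1 * P.2 + b * P.1 + c * P.2 = 1} := by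
  have hpos : 0 < Nat.card F - 1 := by
    have := Finite.one_lt_card (α := F)
    omega
  have hN0 : N ≠ 0 := by rintro rfl; omega
  have hM0 : M ≠ 0 := by rintro rfl; omega
  have hN0' : N' ≠ 0 := by rintro rfl; omega
  have hM0' : M' ≠ 0 := by rintro rfl; omega
  let T := {P : F × F // P.1 ^ N' = 1 ∧ P.2 ^ M' = 1 ∧ a * P.1 * P.2 + b * P.1 + c * P.2 = 1}
  let S := {P : F × F // P.1 * P.2 ≠ 0 ∧ eval ![P.1, P.2] (curvePoly a b c N M) = 0}
  have hfib : ∀ Q : T, Nat.card ({t : F // t ^ N = Q.1.1} × {t : F // t ^ M = Q.1.2}) = N * M := by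
    rintro ⟨⟨u, v⟩, hu, hv, -⟩
    have hu0 : u ≠ 0 := by rintro rfl; simp [hN0'] at hu
    have hv0 : v ≠ 0 := by rintro rfl; simp [hM0'] at hv
    rw [Nat.card_prod, (card_pow_eq hN hu0).2 hu, (card_pow_eq hM hv0).2 hv]
  let f : S → T := fun P => ⟨(P.1.1 ^ N, P.1.2 ^ M),
    (card_pow_eq hN (pow_ne_zero _ (left_ne_zero_of_mul P.2.1))).1.1 ⟨_, rfl⟩,
    (card_pow_eq hM (pow_ne_zero _ (right_ne_zero_of_mul P.2.1))).1.1 ⟨_, rfl⟩,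
    by simpa [eval_curvePoly, sub_eq_zero] using P.2.2⟩
  let e : ∀ Q : T, {P : S // f P = Q} ≃ {t : F // t ^ N = Q.1.1} × {t : F // t ^ M = Q.1.2} :=
    fun Q =>
    { toFun := fun P => (⟨P.1.1.1, congrArg (fun Q => Q.1.1) P.2⟩,
        ⟨P.1.1.2, congrArg (fun Q => Q.1.2) P.2⟩)
      invFun := fun P => ⟨⟨(P.1.1, P.2.1), by
        obtain ⟨⟨x, hx⟩, ⟨y, hy⟩⟩ := P
        obtain ⟨hu, hv, h⟩ := Q.2
        rw [← hx] at hu h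
        rw [← hy] at hv h
        refine ⟨mul_ne_zero ?_ ?_, ?_⟩
        · rintro rfl
          simp [hN0', hN0] at hu
        · rintro rfl
          simp [hM0', hM0] at hv
        · simpa [eval_curvePoly, sub_eq_zero] using h⟩,
        Subtype.ext (Prod.ext P.1.2 P.2.2)⟩
      left_inv := fun _ => rfl
      right_inv := fun _ => rfl }
  have : Finite T := Subtype.finite
  have := Fintype.ofFinite T
  change Nat.card S = N * M * Nat.card T
  rw [← Nat.card_congr (Equiv.sigmaFiberEquiv f), Nat.card_sigma]
  simp only [Nat.card_congr (e _), hfib, Finset.sum_const, Finset.card_univ,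
    Nat.card_eq_fintype_card, smul_eq_mul]
  rw [mul_comm]

theorem card_subtype_prod {α β : Type*} [Fintype α] [Fintype β] (p : α × β → Prop)
    [DecidablePred p] :
    Nat.card {P // p P} = ∑ x, ∑ y, if p (x, y) then 1 else 0 := by
  rw [Nat.card_eq_fintype_card, Fintype.card_subtype, Finset.card_filter, Fintype.sum_prod_type]

theorem card_subtype {α : Type*} [Fintype α] (p : α → Prop) [DecidablePred p] :
    Nat.card {x // p x} = ∑ x, if p x then 1 else 0 := by
  rw [Nat.card_eq_fintype_card, Fintype.card_subtype, Finset.card_filter]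

theorem onCurve_some_some {k : Type*} [Field k] {a b c : k} {n m : ℕ} {x y : k} :
    OnCurve a b c n m (some x) (some y) ↔ eval ![x, y] (curvePoly a b c n m) = 0 := Iff.rfl

theorem onCurve_none_some {k : Type*} [Field k] {a b c : k} {n m : ℕ} {y : k} :
    OnCurve a b c n m none (some y) ↔ a * y ^ m + b = 0 := Iff.rfl

theorem onCurve_some_none {k : Type*} [Field k] {a b c : k} {n m : ℕ} {x : k} :
    OnCurve a b c n m (some x) none ↔ a * x ^ n + c = 0 := Iff.rfl

theorem onCurve_none_none {k : Type*} [Field k] {a b c : k} {n m : ℕ} :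
    OnCurve a b c n m none none ↔ False := Iff.rfl

theorem card_onCurve {k : Type*} [Field k] [Finite k] (a b c : k) {n m : ℕ} (hn : n ≠ 0)
    (hm : m ≠ 0) :
    Nat.card {o : Option k × Option k // OnCurve a b c n m o.1 o.2} =
      numTorusPoints (curvePoly a b c n m) +
        (Nat.card {y : k // c * y ^ m = 1} + Nat.card {y : k // a * y ^ m + b = 0}) +
        (Nat.card {x : k // a * x ^ n + c = 0} + Nat.card {x : k // b * x ^ n = 1}) := by
  classical
  have := Fintype.ofFinite k
  rw [numTorusPoints, card_subtype_prod, card_subtype_prod, card_subtype, card_subtype,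
    card_subtype, card_subtype]
  simp only [Fintype.sum_option, onCurve_some_some, onCurve_none_some,
    onCurve_some_none, onCurve_none_none, if_false, zero_add, Finset.sum_add_distrib]
  -- The two axis terms never overlap, since the origin is not on the curve.
  have key : ∀ x y : k, (if eval ![x, y] (curvePoly a b c n m) = 0 then 1 else 0) =
      (if x * y ≠ 0 ∧ eval ![x, y] (curvePoly a b c n m) = 0 then 1 else 0) +
      ((if x = 0 then if c * y ^ m = 1 then 1 else 0 else 0) +
      (if y = 0 then if b * x ^ n = 1 then 1 else 0 else 0)) := by
    intro x y
    by_cases hx : x = 0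
    · by_cases hy : y = 0
      · simp [hx, hy, eval_curvePoly, hn, hm]
      · simp [hx, hy, eval_curvePoly, hn, sub_eq_zero]
    · by_cases hy : y = 0
      · simp [hx, hy, eval_curvePoly, hm, sub_eq_zero]
      · simp [hx, hy]
  simp only [key, Finset.sum_add_distrib]
  simp only [Finset.sum_ite_eq', Finset.mem_univ, if_true]
  rw [Finset.sum_comm (f := fun x y : k => if x = 0 then if c * y ^ m = 1 then 1 else 0 else 0)]
  simp only [Finset.sum_ite_eq', Finset.mem_univ, if_true]
  ring

theorem mem_fixedSubfield {k : Type*} [Field k] {p : ℕ} [ExpChar k p] {d : ℕ} {x : k} :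
    x ∈ fixedSubfield k p d ↔ x ^ p ^ d = x := by
  simp [fixedSubfield, iterateFrobenius_def]

theorem card_fixedSubfield {k : Type*} [Field k] [Finite k] {p : ℕ} [ExpChar k p] {d : ℕ}
    (hd : 1 < p ^ d) (h : p ^ d - 1 ∣ Nat.card k - 1) :
    Nat.card (fixedSubfield k p d) = p ^ d := by
  classical
  have := Fintype.ofFinite k
  obtain ⟨N', hN'⟩ := h
  have key := (card_pow_eq hN'.symm (one_ne_zero (α := k))).2 (one_pow _)
  have e : Nat.card (fixedSubfield k p d) = Nat.card {x : k // x ^ p ^ d = x} :=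
    Nat.card_congr (Equiv.subtypeEquivRight fun x => mem_fixedSubfield)
  rw [e]
  rw [card_subtype] at key ⊢
  have h1 : ∀ x : k, (if x ^ p ^ d = x then 1 else 0) =
      (if x ^ (p ^ d - 1) = 1 then 1 else 0) + if x = 0 then 1 else 0 := by
    intro x
    by_cases hx : x = 0
    · have : p ^ d - 1 ≠ 0 := by omega
      rw [hx, zero_pow (by omega), zero_pow this]
      simp
    · have : x ^ p ^ d = x ↔ x ^ (p ^ d - 1) = 1 := by
        conv_lhs => rw [← Nat.sub_add_cancel hd.le, pow_succ]
        exact mul_eq_right₀ hx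
      simp [hx, this]
  simp only [h1, Finset.sum_add_distrib, key]
  simp
  omega

theorem card_pow_eq_ite {F : Type*} [Field F] [Finite F] {N N' : ℕ}
    (hN : N * N' = Nat.card F - 1) {d : F} (hd : d ≠ 0) [Decidable (d ^ N' = 1)] :
    Nat.card {t : F // t ^ N = d} = if d ^ N' = 1 then N else 0 := by
  have key := card_pow_eq hN hd
  split_ifs with h
  · exact key.2 h
  · rw [Nat.card_eq_zero]
    exact Or.inl ⟨fun t => h (key.1.1 ⟨t.1, t.2⟩)⟩

/-- Bridge between the torus counts over `k` and over 𝔽_{p^{2r}}. -/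
theorem card_torus_subfield {k : Type*} [Field k] (S : Subfield k) (a b c : S) {N M : ℕ}
    (hN : ∀ x : k, x ^ N = 1 → x ∈ S) (hM : ∀ x : k, x ^ M = 1 → x ∈ S) :
    Nat.card {P : k × k // P.1 ^ N = 1 ∧ P.2 ^ M = 1 ∧
        (a : k) * P.1 * P.2 + b * P.1 + c * P.2 = 1} =
      Nat.card {P : S × S // P.1 ^ N = 1 ∧ P.2 ^ M = 1 ∧
        a * P.1 * P.2 + b * P.1 + c * P.2 = 1} :=
  Nat.card_congr
  { toFun := fun P => ⟨(⟨P.1.1, hN _ P.2.1⟩, ⟨P.1.2, hM _ P.2.2.1⟩),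
      Subtype.ext P.2.1, Subtype.ext P.2.2.1, Subtype.ext P.2.2.2⟩
    invFun := fun P => ⟨(P.1.1, P.1.2), congrArg Subtype.val P.2.1, congrArg Subtype.val P.2.2.1,
      congrArg Subtype.val P.2.2.2⟩
    left_inv := fun _ => rfl
    right_inv := fun _ => rfl }

theorem numRationalPoints_curvePoly {k : Type*} [Field k] [Finite k] {a b c : k} {n m n' m' : ℕ}
    (hn' : n * n' = Nat.card k - 1) (hm' : m * m' = Nat.card k - 1) (hn : (n : k) ≠ 0)
    (hm : (m : k) ≠ 0) (ha : a ≠ 0) (hb : b ≠ 0) (hc : c ≠ 0) (habc : a + b * c ≠ 0)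
    (hf : Irreducible (curvePoly a b c n m)) [DecidableEq k] :
    numRationalPoints (curvePoly a b c n m) hf =
      n * m * Nat.card {P : k × k // P.1 ^ n' = 1 ∧ P.2 ^ m' = 1 ∧
        a * P.1 * P.2 + b * P.1 + c * P.2 = 1} +
      ((if c ^ m' = 1 then m else 0) + (if (-b / a) ^ m' = 1 then m else 0)) +
      ((if (-c / a) ^ n' = 1 then n else 0) + (if b ^ n' = 1 then n else 0)) := by
  have hn0 : n ≠ 0 := by rintro rfl; simp at hn
  have hm0 : m ≠ 0 := by rintro rfl; simp at hm
  have e₁ : Nat.card {y : k // c * y ^ m = 1} = Nat.card {y : k // y ^ m = c⁻¹} :=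
    Nat.card_congr (Equiv.subtypeEquivRight fun y => by
      rw [inv_eq_one_div, eq_div_iff hc, mul_comm])
  have e₂ : Nat.card {y : k // a * y ^ m + b = 0} = Nat.card {y : k // y ^ m = -b / a} :=
    Nat.card_congr (Equiv.subtypeEquivRight fun y => by
      rw [eq_div_iff ha, ← add_eq_zero_iff_eq_neg, mul_comm])
  have e₃ : Nat.card {x : k // a * x ^ n + c = 0} = Nat.card {x : k // x ^ n = -c / a} :=
    Nat.card_congr (Equiv.subtypeEquivRight fun x => by
      rw [eq_div_iff ha, ← add_eq_zero_iff_eq_neg, mul_comm])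
  have e₄ : Nat.card {x : k // b * x ^ n = 1} = Nat.card {x : k // x ^ n = b⁻¹} :=
    Nat.card_congr (Equiv.subtypeEquivRight fun x => by
      rw [inv_eq_one_div, eq_div_iff hb, mul_comm])
  have := isDomain_coordRing hf
  rw [numRationalPoints, (isModel_fractionRing hf hn0 hm0).card_rationalPlace ha hb hc habc hn hm,
    card_onCurve a b c hn0 hm0, numTorusPoints_curvePoly hn' hm', e₁, e₂, e₃, e₄,
    card_pow_eq_ite hm' (inv_ne_zero hc),
    card_pow_eq_ite hm' (div_ne_zero (neg_ne_zero.2 hb) ha),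
    card_pow_eq_ite hn' (div_ne_zero (neg_ne_zero.2 hc) ha), card_pow_eq_ite hn' (inv_ne_zero hb)]
  simp only [inv_pow, inv_eq_one]

theorem memInd_fixedSubfield {k : Type*} [Field k] {p : ℕ} [ExpChar k p] {d : ℕ}
    (hd : 1 < p ^ d) {x : k} (hx : x ≠ 0) [Decidable (x ^ (p ^ d - 1) = 1)] :
    memInd (fixedSubfield k p d) x = if x ^ (p ^ d - 1) = 1 then 1 else 0 := by
  have : x ^ p ^ d = x ↔ x ^ (p ^ d - 1) = 1 := by
    conv_lhs => rw [← Nat.sub_add_cancel hd.le, pow_succ]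
    exact mul_eq_right₀ hx
  simp only [memInd, mem_fixedSubfield, this]

end RatPts

theorem mainTheorem9 {k : Type*} [Field k] [Finite k] (p : ℕ) [Fact p.Prime] [CharP k p]
    (h q : ℕ) (hq : q = p ^ h) (hk : Nat.card k = q)
    (r : ℕ) (hr : 0 < r) (hrh : r < h) (hdvd : 2 * r ∣ h)
    (n m : ℕ) (hn : n = (q - 1) / (p ^ r - 1)) (hm : m = (q - 1) / (p ^ r + 1))
    (a b c : RatPts.fixedSubfield k p (2 * r)) (ha : a ≠ 0) (hb : b ≠ 0) (hc : c ≠ 0)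
    (hcab : c ≠ -a / b)
    (h₁ : -b = c * a ^ p ^ r) (h₂ : -a = c * b ^ p ^ r) (h₃ : c ^ (p ^ r + 1) = 1) :
    ∃ hf : Irreducible (RatPts.curvePoly (a : k) (b : k) (c : k) n m),
      RatPts.numRationalPoints (RatPts.curvePoly (a : k) (b : k) (c : k) n m) hf =
        ((q - 1) / (p ^ (2 * r) - 1)) ^ 2 *
            RatPts.numTorusPoints (RatPts.curvePoly a b c (p ^ r + 1) (p ^ r - 1)) +
          (RatPts.powInd (p ^ r - 1) c + RatPts.powInd (p ^ r - 1) (-b / a)) * m +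
          (RatPts.memInd (RatPts.fixedSubfield k p r) ((-c / a : _) : k) +
            RatPts.memInd (RatPts.fixedSubfield k p r) (b : k)) * n := by
  classical
  have hp := Fact.out (p := p.Prime)
  have hs1 : 1 < p ^ r := Nat.one_lt_pow hr.ne' hp.one_lt
  have hss : p ^ (2 * r) = p ^ r * p ^ r := by rw [two_mul, pow_add]
  -- With `t = p ^ r - 1`, the numbers `t` and `t + 2` are complementary divisors of `p ^ (2 * r) -
  -- 1`; below, `n = (t + 2) D` and `m = t D`.
  obtain ⟨t, hs⟩ : ∃ t, p ^ r = t + 1 := ⟨p ^ r - 1, by omega⟩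
  rw [hs] at hs1 hss hn hm h₁ h₂ h₃ ⊢
  have ht : 0 < t := by omega
  have hss1 : p ^ (2 * r) - 1 = t * (t + 2) := by
    rw [hss]
    have : (t + 1) * (t + 1) = t * (t + 2) + 1 := by ring
    omega
  obtain ⟨D, hD⟩ : p ^ (2 * r) - 1 ∣ q - 1 := by
    obtain ⟨e, rfl⟩ := hdvd
    have := Nat.sub_dvd_pow_sub_pow (p ^ (2 * r)) 1 e
    rwa [one_pow, ← pow_mul, ← hq] at this
  have hn2 : n = (t + 2) * D := by
    rw [hn, hD, hss1, Nat.add_sub_cancel, mul_assoc, Nat.mul_div_cancel_left _ ht]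
  have hm2 : m = t * D := by
    rw [hm, hD, hss1, mul_comm t, mul_assoc, Nat.mul_div_cancel_left _ (by omega)]
  have hDq : (q - 1) / (p ^ (2 * r) - 1) = D := by
    rw [hD, Nat.mul_div_cancel_left]
    rw [hss1]
    positivity
  have hn' : n * t = Nat.card k - 1 := by
    rw [hk, hD, hss1, hn2]; ring
  have hm' : m * (t + 2) = Nat.card k - 1 := by
    rw [hk, hD, hss1, hm2]; ring
  have hcardl : Nat.card (RatPts.fixedSubfield k p (2 * r)) = p ^ (2 * r) :=
    RatPts.card_fixedSubfield (by rw [hss]; nlinarith) (by rw [hk]; exact ⟨D, hD⟩)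
  have hl' : (t + 2) * t = Nat.card (RatPts.fixedSubfield k p (2 * r)) - 1 := by
    rw [hcardl, hss1]; ring
  have hq0 : (q : k) = 0 := by
    rw [hq, Nat.cast_pow, CharP.cast_eq_zero, zero_pow (by omega)]
  have hq1 : 0 < q := by rw [hq]; exact pow_pos hp.pos _
  -- Divisors of `q - 1` are prime to `p`.
  have hcast : ∀ u v : ℕ, u * v = Nat.card k - 1 → (u : k) ≠ 0 := fun u v huv hu => by
    have : u * v + 1 = q := by rw [huv, hk]; omega
    have := congrArg (Nat.cast (R := k)) this
    simp [hu, hq0] at this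
  have ha' : (a : k) ≠ 0 := by simpa using ha
  have hb' : (b : k) ≠ 0 := by simpa using hb
  have hc' : (c : k) ≠ 0 := by simpa using hc
  have habc : (a : k) + b * c ≠ 0 := fun h0 => hcab (by
    rw [eq_div_iff hb]
    apply Subtype.ext
    push_cast
    linear_combination h0)
  have haa : a ^ (p ^ (2 * r)) = a := Subtype.ext (RatPts.mem_fixedSubfield.1 a.2)
  -- With `s = p ^ r`: `(-b) ^ (s + 1) = c ^ (s + 1) a ^ (s² + s) = a ^ (s + 1)`, because `a ^ s² =
  -- a`. Hence both indicators multiplying `m` equal 1.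
  have hba : (-b / a) ^ (t + 2) = 1 := by
    rw [div_pow, div_eq_one_iff_eq (pow_ne_zero _ ha), h₁, mul_pow, h₃, one_mul, ← pow_mul,
      show (t + 1) * (t + 2) = (t + 1) * (t + 1) + (t + 1) by ring, pow_add, ← hss, haa]
    ring
  have hck : (c : k) ^ (t + 2) = 1 := by exact_mod_cast congrArg Subtype.val h₃
  have hbak : (-(b : k) / a) ^ (t + 2) = 1 := by
    have := congrArg Subtype.val hba
    push_cast at this
    exact this
  -- The root needed for Eisenstein exists because `c ^ (p ^ r + 1) = 1` makes `c⁻¹` an `m`-th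
  -- power.
  obtain ⟨η, hη⟩ := (RatPts.card_pow_eq hm' (inv_ne_zero hc')).1.2 (by rw [inv_pow, hck, inv_one])
  have hf := RatPts.irreducible_curvePoly (n := n) hb' hc' habc
    (fun h0 => hcast _ _ hn' (by simp [h0])) (hcast _ _ hm') (η := η)
    (by rw [hη, mul_inv_cancel₀ hc'])
  refine ⟨hf, ?_⟩
  rw [RatPts.numRationalPoints_curvePoly hn' hm' (hcast _ _ hn') (hcast _ _ hm') ha' hb' hc' habc,
    RatPts.numTorusPoints_curvePoly (N' := t) (M' := t + 2) hl'
      (by rw [← hl', Nat.add_sub_cancel, mul_comm]),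
    RatPts.card_torus_subfield]
  · rw [RatPts.memInd_fixedSubfield (by omega) hb',
      RatPts.memInd_fixedSubfield (by omega) (by simpa using ⟨hc, ha⟩), hDq, hs]
    have hpow : ∀ d : RatPts.fixedSubfield k p (2 * r), d ≠ 0 → d ^ (t + 2) = 1 →
        RatPts.powInd t d = 1 := fun d hd h =>
      if_pos ((RatPts.card_pow_eq (N := t) (by rw [← hl', mul_comm]) hd).1.2 h)
    rw [Nat.add_sub_cancel, hpow c hc h₃, hpow _ (div_ne_zero (neg_ne_zero.2 hb) ha) hba,
      if_pos hck, if_pos hbak, hn2, hm2]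
    push_cast
    split_ifs <;> ring
  -- Roots of unity of order dividing `t` or `t + 2` lie in 𝔽_{p^{2r}}, since both divide `p ^ (2 *
  -- r) - 1`.
  all_goals
    intro x hx
    rw [RatPts.mem_fixedSubfield, ← Nat.sub_add_cancel (Nat.one_le_pow (2 * r) p hp.pos), hss1,
      pow_succ]
  · rw [pow_mul, hx, one_pow, one_mul]
  · rw [mul_comm t, pow_mul, hx, one_pow, one_mul]
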